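/- Let $N$ be a positive integer. There exist positive constants $c_5=c_5(N,p,q)$, $c_6=c_6(N,q)$ and $c_7=c_7(N,p)$, defined for all real $p,q$ with $1<q<\min\{p,2\}$ and depending only on the indicated quantities, such that the following holds. Let $1<q<\min\{p,2\}$, let $M\in\mathbb R$, let $\Omega\subset\mathbb R^N$ be a domain (a nonempty connected open set, not necessarily bounded) with $0\in\partial\Omega$, and let $u\in C^1(\overline\Omega\setminus\{0\})$ (that is, $u$ is continuous on $\overline\Omega\setminus\{0\}$ and $C^1$ in $\Omega$, and $\nabla u$ extends continuously to $\overline\Omega\setminus\{0\}$) be a solution, in the sense of distributions in $\Omega$, of $$-\Delta u+|u|^{p-1}u-M|\nabla u|^q=0 ,$$ with $u=0$ on $\partial\Omega\setminus\{0\}$. Write $u_+=\max\{u,0\}$. 1. If $M>0$, then $$u_+(x)\le c_5\max\left\{M^{\frac1{p-q}}|x|^{-\frac q{p-q}},\ |x|^{-\frac2{p-1}}\right\}\qquad\text{for all }x\in\Omega .$$ 2. If $M\le 0$, then $$u_+(x)\le \min\left\{c_6|M|^{-\frac1{q-1}}|x|^{-\frac{2-q}{q-1}},\ c_7|x|^{-\frac2{p-1}}\right\}\qquad\text{for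 all }x\in\Omega ,$$ where for $M=0$ the first term in the minimum is understood as $+\infty$, so that the estimate reads $u_+(x)\le c_7|x|^{-\frac2{p-1}}$. -/

import Mathlib

open scoped ContDiff Laplacian Gradient

/-- `u ∈ C¹(A̅ ∖ {0})` for an open set `A`: `u` is `C¹` in `A`, continuous on `A̅ ∖ {0}`,
and `∇u` extends continuously from `A` to `A̅ ∖ {0}`. -/
def IsC1OffOrigin {N : ℕ} (A : Set (EuclideanSpace ℝ (Fin N)))
    (u : EuclideanSpace ℝ (Fin N) → ℝ) : Prop :=
  ContDiffOn ℝ 1 u A ∧ ContinuousOn u (closure A \ {0}) ∧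
    ∃ G : EuclideanSpace ℝ (Fin N) → EuclideanSpace ℝ (Fin N),
      ContinuousOn G (closure A \ {0}) ∧ ∀ x ∈ A, G x = ∇ u x

/-- `-Δu + |u|^{p-1} u - M |∇u|^q = 0` in the sense of distributions in the open set `A`
(for `u` of class `C¹` in `A`). -/
def SolvesInDistributions {N : ℕ} (p q M : ℝ) (A : Set (EuclideanSpace ℝ (Fin N)))
    (u : EuclideanSpace ℝ (Fin N) → ℝ) : Prop :=
  ∀ φ : EuclideanSpace ℝ (Fin N) → ℝ,
    ContDiff ℝ ∞ φ → HasCompactSupport φ → tsupport φ ⊆ A →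
      ∫ x in A, (-(u x * Δ φ x) + (|u x| ^ (p - 1) * u x - M * ‖∇ u x‖ ^ q) * φ x) = 0

/-
A distributional `C¹` solution is a viscosity subsolution: where a `C²` function `w` touches it from
above, mollification gives `|u|^{p-1} u - M |∇u|^q ≤ Δ w`. Since the absorption is strictly
increasing in `u`, the solution stays below every supersolution that dominates it on the boundary,
and a supersolution `D σ⁻ᵏ + ε` that blows up where `σ = 0` needs no boundary information there
(Keller, Osserman). On the ball of radius `|x₀| / 2` about `x₀`, which avoids the origin, take
`σ = 1 - |x - x₀|² / r²`: the absorption dominates both the Laplacian and a gradient source. When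
the gradient term is itself an absorption, take `σ = ⟪e, x⟫ - δ` with `e = x₀ / |x₀|` on a
half-space, where the ball bound supplies decay at infinity, and let `ε = δ → 0`.
-/

open Set Filter Topology MeasureTheory Metric InnerProductSpace

theorem deriv_deriv_nonpos_of_isLocalMax {g : ℝ → ℝ} {t : ℝ} (hg : ContinuousAt g t)
    (hmax : IsLocalMax g t) : deriv (deriv g) t ≤ 0 := by
  by_contra! hpos
  have hmin := isLocalMin_of_deriv_deriv_pos hpos hmax.deriv_eq_zero hg
  have hconst : g =ᶠ[𝓝 t] fun _ => g t := by
    filter_upwards [hmin, hmax] with s h₁ h₂ using le_antisymm h₂ h₁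
  have : deriv (deriv g) t = 0 := by
    rw [hconst.deriv.deriv_eq]
    simp
  exact hpos.ne' this

theorem fderiv_fderiv_apply_apply_nonpos_of_isLocalMax {F : Type*} [NormedAddCommGroup F]
    [NormedSpace ℝ F] {g : F → ℝ} {x : F} (hg : ContDiffAt ℝ 2 g x) (hmax : IsLocalMax g x)
    (e : F) : fderiv ℝ (fderiv ℝ g) x e e ≤ 0 := by
  set line : ℝ → F := fun t => x + t • e with hline
  have hline₀ : line 0 = x := by simp [hline]
  have hline' : ∀ t, HasDerivAt line e t := fun t => by
    simpa only [id, one_smul] using ((hasDerivAt_id t).smul_const e).const_add x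
  have htendsto : Tendsto line (𝓝 0) (𝓝 x) := hline₀ ▸ (hline' 0).continuousAt.tendsto
  have hderiv : deriv (g ∘ line) =ᶠ[𝓝 0] fun t => fderiv ℝ g (line t) e := by
    filter_upwards [htendsto.eventually (hg.eventually (by simp))] with t ht
    exact ((ht.differentiableAt (by norm_num)).hasFDerivAt.comp_hasDerivAt t (hline' t)).deriv
  have hg' : HasFDerivAt (fderiv ℝ g) (fderiv ℝ (fderiv ℝ g) x) (line 0) := by
    rw [hline₀]
    exact ((hg.fderiv_right (m := 1) (by norm_num)).differentiableAt (by norm_num)).hasFDerivAt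
  have hderiv₂ : deriv (deriv (g ∘ line)) 0 = fderiv ℝ (fderiv ℝ g) x e e := by
    rw [hderiv.deriv_eq]
    simpa using ((hg'.comp_hasDerivAt 0 (hline' 0)).clm_apply (hasDerivAt_const 0 e)).deriv
  rw [← hderiv₂]
  rw [← hline₀] at hg hmax
  exact deriv_deriv_nonpos_of_isLocalMax (hg.continuousAt.comp (hline' 0).continuousAt)
    (hmax.comp_continuous (hline' 0).continuousAt)

theorem fderiv_comp_const_sub {F G : Type*} [NormedAddCommGroup F] [NormedSpace ℝ F]
    [NormedAddCommGroup G] [NormedSpace ℝ G] (f : F → G) (z y : F) :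
    fderiv ℝ (fun y => f (z - y)) y = -fderiv ℝ f (z - y) := by
  have := fderiv_comp_sub (𝕜 := ℝ) (f := f ∘ ContinuousLinearEquiv.neg ℝ) (x := y) z
  rw [ContinuousLinearEquiv.comp_right_fderiv] at this
  ext v
  simpa using congr($this v)

section Laplacian

variable {E : Type*} [NormedAddCommGroup E] [InnerProductSpace ℝ E]

theorem fderiv_norm_sub_sq (a : E) :
    fderiv ℝ (fun y => ‖y - a‖ ^ 2) = fun y => 2 • innerSL ℝ (y - a) := by
  ext1 y
  rw [fderiv_comp_sub (f := fun y => ‖y‖ ^ 2), fderiv_norm_sq_apply]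

theorem contDiff_norm_sub_sq (a : E) : ContDiff ℝ 2 fun y => ‖y - a‖ ^ 2 :=
  (contDiff_id.sub contDiff_const).norm_sq ℝ

theorem fderiv_inner_sub_const (e : E) (δ : ℝ) :
    fderiv ℝ (fun y => inner ℝ e y - δ) = fun _ => innerSL ℝ e :=
  funext fun _ => ((innerSL ℝ e).hasFDerivAt.sub_const δ).fderiv

variable [FiniteDimensional ℝ E]

theorem laplacian_eq_sum_fderiv_fderiv {ι : Type*} [Fintype ι] (v : OrthonormalBasis ι ℝ E)
    (f : E → ℝ) (x : E) : Δ f x = ∑ i, fderiv ℝ (fderiv ℝ f) x (v i) (v i) := by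
  simp [laplacian_eq_iteratedFDeriv_orthonormalBasis f v, iteratedFDeriv_two_apply]

theorem continuousAt_laplacian {f : E → ℝ} {x : E} (hf : ContDiffAt ℝ 2 f x) :
    ContinuousAt (Δ f) x := by
  have hcont : ContinuousAt (fderiv ℝ (fderiv ℝ f)) x :=
    ((hf.fderiv_right (m := 1) (by norm_num)).fderiv_right (m := 0) (by norm_num)).continuousAt
  rw [show Δ f = _ from funext (laplacian_eq_sum_fderiv_fderiv (stdOrthonormalBasis ℝ E) f)]
  fun_prop

theorem laplacian_nonpos_of_isLocalMax {f : E → ℝ} {x : E} (hf : ContDiffAt ℝ 2 f x)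
    (hmax : IsLocalMax f x) : Δ f x ≤ 0 := by
  rw [laplacian_eq_sum_fderiv_fderiv (stdOrthonormalBasis ℝ E)]
  exact Finset.sum_nonpos fun i _ => fderiv_fderiv_apply_apply_nonpos_of_isLocalMax hf hmax _

theorem laplacian_le_of_isLocalMax_sub {f g : E → ℝ} {x : E} (hf : ContDiffAt ℝ 2 f x)
    (hg : ContDiffAt ℝ 2 g x) (hmax : IsLocalMax (f - g) x) : Δ f x ≤ Δ g x := by
  rw [← sub_nonpos, ← hf.laplacian_sub hg]
  exact laplacian_nonpos_of_isLocalMax (hf.sub hg) hmax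

theorem laplacian_comp_const_sub (f : E → ℝ) (z y : E) :
    Δ (fun y => f (z - y)) y = Δ f (z - y) := by
  simp_rw [laplacian_eq_sum_fderiv_fderiv (stdOrthonormalBasis ℝ E),
    funext (fderiv_comp_const_sub f z)]
  rw [fderiv_fun_neg, fderiv_comp_const_sub]
  simp

theorem gradient_comp {h : ℝ → ℝ} {φ : E → ℝ} {x : E} (hh : DifferentiableAt ℝ h (φ x))
    (hφ : DifferentiableAt ℝ φ x) : ∇ (fun y => h (φ y)) x = deriv h (φ x) • ∇ φ x := by
  have := (hh.hasDerivAt.comp_hasFDerivAt x hφ.hasFDerivAt).fderiv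
  simp only [Function.comp_def] at this
  simp [gradient, this]

theorem laplacian_comp {h : ℝ → ℝ} {φ : E → ℝ} {x : E} (hh : ContDiffAt ℝ 2 h (φ x))
    (hφ : ContDiffAt ℝ 2 φ x) : Δ (fun y => h (φ y)) x =
      deriv (deriv h) (φ x) * ‖∇ φ x‖ ^ 2 + deriv h (φ x) * Δ φ x := by
  have hfderiv : fderiv ℝ (fun y => h (φ y)) =ᶠ[𝓝 x] fun y => deriv h (φ y) • fderiv ℝ φ y := by
    filter_upwards [hφ.continuousAt.eventually (hh.eventually (by simp)),
      hφ.eventually (by simp)] with y hhy hφy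
    exact ((hhy.differentiableAt (by norm_num)).hasDerivAt.comp_hasFDerivAt y
      (hφy.differentiableAt (by norm_num)).hasFDerivAt).fderiv
  have hh' : HasDerivAt (deriv h) (deriv (deriv h) (φ x)) (φ x) :=
    ((hh.derivWithin (m := 1) (by norm_num)).differentiableAt (by norm_num)).hasDerivAt
  have hφ' : HasFDerivAt (fderiv ℝ φ) (fderiv ℝ (fderiv ℝ φ) x) x :=
    ((hφ.fderiv_right (m := 1) (by norm_num)).differentiableAt (by norm_num)).hasFDerivAt
  have hsmul : HasFDerivAt (fun y => deriv h (φ y) • fderiv ℝ φ y) _ x :=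
    (hh'.comp_hasFDerivAt x (hφ.differentiableAt (by norm_num)).hasFDerivAt).smul hφ'
  have hnorm := (stdOrthonormalBasis ℝ E).sum_sq_norm_inner_right (∇ φ x)
  simp only [inner_gradient_right, Real.norm_eq_abs, sq_abs, conj_trivial] at hnorm
  simp only [laplacian_eq_sum_fderiv_fderiv (stdOrthonormalBasis ℝ E), hfderiv.fderiv_eq,
    hsmul.fderiv, ← hnorm, Finset.mul_sum, ← Finset.sum_add_distrib]
  refine Finset.sum_congr rfl fun i _ => ?_
  simp
  ring

theorem gradient_norm_sub_sq (a x : E) : ∇ (fun y => ‖y - a‖ ^ 2) x = (2 : ℝ) • (x - a) := by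
  refine (toDual ℝ E).injective ?_
  rw [toDual_gradient, fderiv_norm_sub_sq]
  ext v
  simp

theorem laplacian_norm_sub_sq (a x : E) :
    Δ (fun y => ‖y - a‖ ^ 2) x = 2 * Module.finrank ℝ E := by
  have hfderiv₂ : HasFDerivAt (fun y => 2 • innerSL ℝ (y - a)) (2 • innerSL ℝ (E := E)) x :=
    ((innerSL ℝ (E := E)).hasFDerivAt.comp x ((hasFDerivAt_id x).sub_const a)).const_smul 2
  have hdiag : ∀ v : E, (2 • innerSL ℝ (E := E)) v v = 2 * ‖v‖ ^ 2 := fun v =>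
    (nsmul_eq_mul 2 _).trans (congrArg _ (real_inner_self_eq_norm_sq v))
  simp_rw [laplacian_eq_sum_fderiv_fderiv (stdOrthonormalBasis ℝ E), fderiv_norm_sub_sq,
    hfderiv₂.fderiv, hdiag]
  simp [mul_comm]

theorem gradient_inner_sub_const (e : E) (δ : ℝ) (x : E) :
    ∇ (fun y => inner ℝ e y - δ) x = e := by
  refine (toDual ℝ E).injective ?_
  rw [toDual_gradient, fderiv_inner_sub_const]
  rfl

theorem laplacian_inner_sub_const (e : E) (δ : ℝ) (x : E) :
    Δ (fun y => inner ℝ e y - δ) x = 0 := by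
  simp [laplacian_eq_sum_fderiv_fderiv (stdOrthonormalBasis ℝ E), fderiv_inner_sub_const]

end Laplacian

section BlowupProfile

/-- The profile `t ↦ D t⁻ᵏ + ε` of the barriers, which blow up as `t ↓ 0`. -/
noncomputable def blowupProfile (D k ε t : ℝ) : ℝ := D * t ^ (-k) + ε

namespace blowupProfile

variable {D k ε t : ℝ}

theorem pos (hD : 0 < D) (hε : 0 ≤ ε) (ht : 0 < t) : 0 < blowupProfile D k ε t := by
  have := Real.rpow_pos_of_pos ht (-k)
  unfold blowupProfile
  positivity

theorem zero_rpow (hD : 0 ≤ D) (ht : 0 ≤ t) (p : ℝ) :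
    blowupProfile D k 0 t ^ p = D ^ p * t ^ (-(k * p)) := by
  rw [blowupProfile, add_zero, Real.mul_rpow hD (by positivity), ← Real.rpow_mul ht, neg_mul]

theorem deriv_eq (D k ε : ℝ) :
    deriv (blowupProfile D k ε) = fun t => -(D * k) * t ^ (-(k + 1)) := by
  ext t
  unfold blowupProfile
  rw [deriv_add_const, deriv_const_mul_field, Real.deriv_rpow_const, neg_add', ← mul_assoc,
    mul_neg]

theorem deriv_deriv_eq (D k ε : ℝ) :
    deriv (deriv (blowupProfile D k ε)) = fun t => D * k * (k + 1) * t ^ (-(k + 2)) := by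
  ext t
  rw [deriv_eq, deriv_const_mul_field, Real.deriv_rpow_const]
  ring_nf

theorem contDiffAt (ht : t ≠ 0) : ContDiffAt ℝ 2 (blowupProfile D k ε) t :=
  (contDiffAt_const.mul (contDiffAt_id.rpow_const_of_ne ht)).add contDiffAt_const

theorem exists_lt_le (hD : 0 < D) (hk : 0 < k) (B : ℝ) (ht : 0 < t) :
    ∃ τ, 0 < τ ∧ τ < t ∧ B ≤ blowupProfile D k ε τ := by
  have htop : Tendsto (blowupProfile D k ε) (𝓝[>] 0) atTop :=
    tendsto_atTop_add_const_right _ ε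
      ((tendsto_rpow_neg_nhdsGT_zero (neg_lt_zero.2 hk)).const_mul_atTop hD)
  obtain ⟨τ, hB, hτ⟩ := ((htop.eventually_ge_atTop B).and (Ioo_mem_nhdsGT ht)).exists
  exact ⟨τ, hτ.1, hτ.2, hB⟩

variable {E : Type*} [NormedAddCommGroup E] [InnerProductSpace ℝ E] [FiniteDimensional ℝ E]
  {σ : E → ℝ} {x : E}

theorem norm_gradient_comp (hD : 0 ≤ D) (hk : 0 ≤ k) (hσ : DifferentiableAt ℝ σ x) (hx : 0 < σ x) :
    ‖∇ (fun y => blowupProfile D k ε (σ y)) x‖ = D * k * σ x ^ (-(k + 1)) * ‖∇ σ x‖ := by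
  have := Real.rpow_pos_of_pos hx (-(k + 1))
  rw [gradient_comp ((contDiffAt hx.ne').differentiableAt (by norm_num)) hσ, norm_smul,
    Real.norm_eq_abs, deriv_eq]
  simp only [neg_mul, abs_neg]
  rw [abs_of_nonneg (by positivity)]

theorem laplacian_comp (hσ : ContDiffAt ℝ 2 σ x) (hx : 0 < σ x) :
    Δ (fun y => blowupProfile D k ε (σ y)) x =
      D * k * (k + 1) * σ x ^ (-(k + 2)) * ‖∇ σ x‖ ^ 2 - D * k * σ x ^ (-(k + 1)) * Δ σ x := by
  rw [_root_.laplacian_comp (contDiffAt hx.ne') hσ, deriv_deriv_eq, deriv_eq]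
  ring

end blowupProfile

end BlowupProfile

section Mollification

theorem integrable_mul_of_tsupport_subset {X : Type*} [TopologicalSpace X] [MeasurableSpace X]
    [OpensMeasurableSpace X] {μ : Measure X} [IsFiniteMeasureOnCompacts μ] {K B : Set X}
    {v ψ : X → ℝ} (hB : IsOpen B) (hv : ContinuousOn v B) (hψ : Continuous ψ)
    (hK : IsCompact K) (hKB : K ⊆ B) (hψK : tsupport ψ ⊆ K) :
    Integrable (fun x => v x * ψ x) μ :=
  ((hv.mul hψ.continuousOn).continuous_of_tsupport_subset hB
    (tsupport_mul_subset_right.trans (hψK.trans hKB))).integrable_of_hasCompactSupport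
    (hK.of_isClosed_subset isClosed_closure (tsupport_mul_subset_right.trans hψK))

theorem fderiv_convolution_lsmul_apply {G : Type*} [NormedAddCommGroup G] [NormedSpace ℝ G]
    [MeasurableSpace G] [BorelSpace G] {μ : Measure G} [SFinite μ] [μ.IsAddLeftInvariant]
    {g η : G → ℝ} (hg : LocallyIntegrable g μ) (hη : ContDiff ℝ 1 η)
    (hηc : HasCompactSupport η) (x e : G) :
    fderiv ℝ (convolution g η (ContinuousLinearMap.lsmul ℝ ℝ) μ) x e =
      convolution g (fun y => fderiv ℝ η y e) (ContinuousLinearMap.lsmul ℝ ℝ) μ x := by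
  have := hηc.hasFDerivAt_convolution_right (ContinuousLinearMap.lsmul ℝ ℝ) hg hη x
  rw [this.fderiv]
  exact convolution_precompR_apply _ hg (hηc.fderiv ℝ) (hη.continuous_fderiv (by norm_num)) x e

variable {E : Type*} [NormedAddCommGroup E] [InnerProductSpace ℝ E] [FiniteDimensional ℝ E]

theorem laplacian_eq_zero_of_notMem_tsupport {φ : E → ℝ} {x : E} (hx : x ∉ tsupport φ) :
    Δ φ x = 0 := by
  rw [(laplacian_congr_nhds (notMem_tsupport_iff_eventuallyEq.1 hx)).eq_of_nhds]
  exact congrFun laplacian_const x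

theorem tsupport_laplacian_subset (φ : E → ℝ) : tsupport (Δ φ) ⊆ tsupport φ :=
  closure_minimal (fun _ => not_imp_comm.1 laplacian_eq_zero_of_notMem_tsupport) isClosed_closure

theorem continuous_laplacian {φ : E → ℝ} (hφ : ContDiff ℝ 2 φ) : Continuous (Δ φ) :=
  continuous_iff_continuousAt.2 fun _ => continuousAt_laplacian hφ.contDiffAt

variable [MeasurableSpace E] [BorelSpace E]

theorem laplacian_convolution {μ : Measure E} [SFinite μ] [μ.IsAddLeftInvariant]
    {g η : E → ℝ} (hg : LocallyIntegrable g μ) (hη : ContDiff ℝ 2 η)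
    (hηc : HasCompactSupport η) (x : E) :
    Δ (convolution g η (ContinuousLinearMap.lsmul ℝ ℝ) μ) x =
      convolution g (Δ η) (ContinuousLinearMap.lsmul ℝ ℝ) μ x := by
  set L := ContinuousLinearMap.lsmul ℝ ℝ (E := ℝ)
  have happly : ∀ {f : E → ℝ}, ContDiff ℝ 2 f → ∀ y e,
      fderiv ℝ (fderiv ℝ f) y e e = fderiv ℝ (fun z => fderiv ℝ f z e) y e := fun hf y e => by
    have := ((hf.fderiv_right (m := 1) (by norm_num)).differentiable (by norm_num)) y
    rw [fderiv_clm_apply this (differentiableAt_const e)]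
    simp
  have hη' : ∀ e, ContDiff ℝ 1 fun y => fderiv ℝ η y e := fun e =>
    (hη.fderiv_right (by norm_num)).clm_apply contDiff_const
  have hterm : ∀ e, fderiv ℝ (fderiv ℝ (convolution g η L μ)) x e e =
      convolution g (fun y => fderiv ℝ (fderiv ℝ η) y e e) L μ x := fun e => by
    simp_rw [happly hη, happly (hηc.contDiff_convolution_right L hg hη)]
    rw [← fderiv_convolution_lsmul_apply hg (hη' e) (hηc.fderiv_apply ℝ e)]
    simp_rw [L, fderiv_convolution_lsmul_apply hg (hη.of_le (by norm_num)) hηc]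
  simp_rw [convolution, laplacian_eq_sum_fderiv_fderiv (stdOrthonormalBasis ℝ E), hterm, map_sum]
  refine (integral_finsetSum _ fun i _ => ?_).symm
  simp_rw [happly hη]
  exact ((hηc.fderiv_apply ℝ _).fderiv_apply ℝ _).convolutionExists_right L hg
    (((hη' _).continuous_fderiv (by norm_num)).clm_apply continuous_const) x

theorem laplacian_convolution_eq_integral {μ : Measure E} [SFinite μ] [μ.IsAddLeftInvariant]
    {g η : E → ℝ} (hg : LocallyIntegrable g μ) (hη : ContDiff ℝ 2 η)
    (hηc : HasCompactSupport η) (x : E) :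
    Δ (convolution g η (ContinuousLinearMap.lsmul ℝ ℝ) μ) x =
      ∫ y, g y * Δ (fun y => η (x - y)) y ∂μ := by
  rw [laplacian_convolution hg hη hηc, convolution_lsmul]
  simp_rw [laplacian_comp_const_sub, smul_eq_mul]

theorem convolution_lsmul_comm (μ : Measure E) [μ.IsAddHaarMeasure] (f g : E → ℝ) :
    convolution f g (ContinuousLinearMap.lsmul ℝ ℝ) μ =
      convolution g f (ContinuousLinearMap.lsmul ℝ ℝ) μ := by
  ext x
  rw [convolution_lsmul, convolution_lsmul_swap]
  simp only [smul_eq_mul, mul_comm]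

/-- `f ≤ Δ u` in the sense of distributions in the open set `A`. -/
def DistribLeLaplacian (μ : Measure E) (f : E → ℝ) (A : Set E) (u : E → ℝ) : Prop :=
  ∀ φ : E → ℝ, ContDiff ℝ ∞ φ → HasCompactSupport φ → tsupport φ ⊆ A → (∀ x, 0 ≤ φ x) →
    ∫ x in A, (-(u x * Δ φ x) + f x * φ x) ∂μ ≤ 0

theorem DistribLeLaplacian.mono {μ : Measure E} [IsFiniteMeasureOnCompacts μ] {f g u : E → ℝ}
    {A B : Set E} (h : DistribLeLaplacian μ f A u) (hB : IsOpen B) (hBA : B ⊆ A)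
    (hf : ContinuousOn f B) (hg : ContinuousOn g B) (hu : ContinuousOn u B)
    (hgf : ∀ x ∈ B, g x ≤ f x) : DistribLeLaplacian μ g B u := by
  intro φ hφ hφc hφB hφ₀
  have hΔφ : Continuous (Δ φ) := continuous_laplacian (contDiff_infty.1 hφ 2)
  have hu' := (integrable_mul_of_tsupport_subset (μ := μ) hB hu hΔφ hφc hφB
    (tsupport_laplacian_subset φ)).neg
  have hf' := integrable_mul_of_tsupport_subset (μ := μ) hB hf hφ.continuous hφc hφB le_rfl
  have hg' := integrable_mul_of_tsupport_subset (μ := μ) hB hg hφ.continuous hφc hφB le_rfl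
  have hzero : ∀ x, x ∉ tsupport φ → -(u x * Δ φ x) + f x * φ x = 0 := fun x hx => by
    simp [laplacian_eq_zero_of_notMem_tsupport hx, image_eq_zero_of_notMem_tsupport hx]
  have hBA' : ∫ x in B, (-(u x * Δ φ x) + f x * φ x) ∂μ =
      ∫ x in A, (-(u x * Δ φ x) + f x * φ x) ∂μ := by
    rw [setIntegral_eq_integral_of_forall_compl_eq_zero fun x hx => hzero x fun h => hx (hφB h),
      setIntegral_eq_integral_of_forall_compl_eq_zero
        fun x hx => hzero x fun h => hx (hBA (hφB h))]
  refine le_trans ?_ (hBA'.trans_le (h φ hφ hφc (hφB.trans hBA) hφ₀))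
  refine setIntegral_mono_on (hu'.add hg').integrableOn (hu'.add hf').integrableOn
    hB.measurableSet fun x hx => ?_
  exact add_le_add le_rfl (mul_le_mul_of_nonneg_right (hgf x hx) (hφ₀ x))

theorem DistribLeLaplacian.le_laplacian_convolution {μ : Measure E} [μ.IsAddHaarMeasure] {m : ℝ}
    {u v : E → ℝ} {A : Set E} (h : DistribLeLaplacian μ (fun _ => m) A u)
    (hv : LocallyIntegrable v μ) (b : ContDiffBump (0 : E)) {x : E} (hA : closedBall x b.rOut ⊆ A)
    (huv : EqOn u v (closedBall x b.rOut)) :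
    m ≤ Δ (convolution v (b.normed μ) (ContinuousLinearMap.lsmul ℝ ℝ) μ) x := by
  set φ : E → ℝ := fun y => b.normed μ (x - y)
  have hφ : ContDiff ℝ ∞ φ := b.contDiff_normed.comp (contDiff_const.sub contDiff_id)
  have hφc : HasCompactSupport φ :=
    b.hasCompactSupport_normed.comp_homeomorph (Homeomorph.subLeft x)
  have hφt : tsupport φ = closedBall x b.rOut := by
    rw [show φ = b.normed μ ∘ Homeomorph.subLeft x from rfl, tsupport_comp_eq_preimage,
      b.tsupport_normed_eq]
    ext y
    simp [dist_eq_norm, norm_sub_rev]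
  have hΔφ : Continuous (Δ φ) := continuous_laplacian (contDiff_infty.1 hφ 2)
  have hzero : ∀ {y}, y ∉ closedBall x b.rOut → Δ φ y = 0 ∧ φ y = 0 := fun hy => by
    rw [← hφt] at hy
    exact ⟨laplacian_eq_zero_of_notMem_tsupport hy, image_eq_zero_of_notMem_tsupport hy⟩
  have huv' : ∀ y, u y * Δ φ y = v y * Δ φ y := fun y => by
    by_cases hy : y ∈ closedBall x b.rOut
    · rw [huv hy]
    · simp [hzero hy]
  have hweak := h φ hφ hφc (hφt.trans_subset hA) fun y => b.nonneg_normed _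
  rw [setIntegral_eq_integral_of_forall_compl_eq_zero fun y hy => by simp [hzero (hy ∘ (hA ·))]]
    at hweak
  simp_rw [huv'] at hweak
  have hvΔφ : Integrable (fun y => v y * Δ φ y) μ :=
    hv.integrable_smul_right_of_hasCompactSupport hΔφ
      (hφc.mono' ((subset_tsupport _).trans (tsupport_laplacian_subset φ)))
  have hmass : ∫ y, m * φ y ∂μ = m := by
    rw [integral_const_mul, integral_sub_left_eq_self (b.normed μ) μ x, b.integral_normed, mul_one]
  rw [integral_add (f := fun y => -(v y * Δ φ y)) hvΔφ.neg
    ((hφ.continuous.integrable_of_hasCompactSupport hφc).const_mul m), integral_neg,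
    hmass] at hweak
  rw [laplacian_convolution_eq_integral hv (contDiff_infty.1 b.contDiff_normed 2)
    b.hasCompactSupport_normed]
  linarith

end Mollification

theorem exists_cthickening_subset_forall_dist_le {X Y : Type*} [PseudoMetricSpace X]
    [ProperSpace X] [PseudoMetricSpace Y] {u : X → Y} {A K : Set X} (hA : IsOpen A)
    (hu : ContinuousOn u A) (hK : IsCompact K) (hKA : K ⊆ A) {ε : ℝ} (hε : 0 < ε) :
    ∃ s, 0 < s ∧ cthickening s K ⊆ A ∧ ∀ x ∈ K, ∀ y, dist y x < s → dist (u y) (u x) ≤ ε := by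
  obtain ⟨δ, hδ, hδA⟩ := hK.exists_cthickening_subset_open hA hKA
  obtain ⟨s, hs, hsu⟩ := Metric.uniformContinuousOn_iff.1
    (hK.cthickening.uniformContinuousOn_of_continuous (hu.mono hδA)) ε hε
  refine ⟨min δ s, lt_min hδ hs, (cthickening_mono (min_le_left _ _) K).trans hδA,
    fun x hx y hyx => (hsu y ?_ x (self_subset_cthickening K hx) ?_).le⟩
  · exact mem_cthickening_of_dist_le y x δ K hx (hyx.le.trans (min_le_left _ _))
  · exact hyx.trans_le (min_le_right _ _)

section Touching

variable {E : Type*} [NormedAddCommGroup E] [InnerProductSpace ℝ E] [FiniteDimensional ℝ E]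
  [MeasurableSpace E] [BorelSpace E] {μ : Measure E} [μ.IsAddHaarMeasure] {u f w : E → ℝ}
  {A : Set E}

theorem DistribLeLaplacian.exists_contDiff_approx {m : ℝ} {K : Set E}
    (h : DistribLeLaplacian μ (fun _ => m) A u) (hA : IsOpen A) (hu : ContinuousOn u A)
    (hK : IsCompact K) (hKA : K ⊆ A) {ε : ℝ} (hε : 0 < ε) :
    ∃ V : E → ℝ, ContDiff ℝ 2 V ∧ ∀ x ∈ K, dist (V x) (u x) ≤ ε ∧ m ≤ Δ V x := by
  obtain ⟨s, hs, hsA, hsu⟩ := exists_cthickening_subset_forall_dist_le hA hu hK hKA hε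
  set v := (cthickening s K).indicator u
  have hv : LocallyIntegrable v μ :=
    (((hu.mono hsA).integrableOn_compact hK.cthickening).integrable_indicator
      isClosed_cthickening.measurableSet).locallyIntegrable
  have huv : ∀ x ∈ K, EqOn v u (closedBall x s) := fun x hx =>
    (eqOn_indicator (s := cthickening s K)).mono (closedBall_subset_cthickening hx s)
  let b : ContDiffBump (0 : E) := ⟨s / 2, s, half_pos hs, half_lt_self hs⟩
  refine ⟨convolution v (b.normed μ) (ContinuousLinearMap.lsmul ℝ ℝ) μ,
    b.hasCompactSupport_normed.contDiff_convolution_right _ hv b.contDiff_normed,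
    fun x hx => ⟨?_, ?_⟩⟩
  · rw [convolution_lsmul_comm, ← huv x hx (mem_closedBall_self hs.le)]
    refine b.dist_normed_convolution_le hv.aestronglyMeasurable fun y hy => ?_
    rw [huv x hx (mem_closedBall_self hs.le), huv x hx (ball_subset_closedBall hy)]
    exact hsu x hx y hy
  · exact h.le_laplacian_convolution hv b ((closedBall_subset_cthickening hx s).trans hsA)
      (huv x hx).symm

theorem DistribLeLaplacian.exists_mem_ball_le_laplacian {m ρ δ : ℝ} {x : E}
    (h : DistribLeLaplacian μ (fun _ => m) A u) (hA : IsOpen A) (hu : ContinuousOn u A)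
    (hρA : closedBall x ρ ⊆ A) (hρ : 0 < ρ) (hδ : 0 < δ)
    (hw : ∀ y ∈ closedBall x ρ, ContDiffAt ℝ 2 w y)
    (hmax : ∀ y ∈ closedBall x ρ, u y - w y ≤ u x - w x - δ * ‖y - x‖ ^ 2) :
    ∃ z ∈ ball x ρ, m ≤ Δ w z := by
  obtain ⟨V, hV, happrox⟩ := h.exists_contDiff_approx hA hu (isCompact_closedBall x ρ) hρA
    (ε := δ * ρ ^ 2 / 3) (by positivity)
  have hcont : ContinuousOn (V - w) (closedBall x ρ) := fun y hy =>
    (hV.continuous.continuousAt.sub (hw y hy).continuousAt).continuousWithinAt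
  have hlt : ∀ y ∈ closedBall x ρ \ ball x ρ, (V - w) y < (V - w) x := fun y hy => by
    have hyρ : ‖y - x‖ = ρ := by
      rw [← dist_eq_norm]
      exact le_antisymm hy.1 (not_lt.1 hy.2)
    have hVy := abs_le.1 (happrox y hy.1).1
    have hVx := abs_le.1 (happrox x (mem_closedBall_self hρ.le)).1
    have hy' := hmax y hy.1
    have : 0 < δ * ρ ^ 2 := by positivity
    rw [hyρ] at hy'
    simp only [Pi.sub_apply]
    linarith [hVy.2, hVx.1]
  obtain ⟨z, hz, hzmax⟩ := (isCompact_closedBall x ρ).exists_isLocalMax_mem_open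
    ball_subset_closedBall hcont (mem_closedBall_self hρ.le) hlt isOpen_ball
  have hz' := ball_subset_closedBall hz
  exact ⟨z, hz, (happrox z hz').2.trans
    (laplacian_le_of_isLocalMax_sub hV.contDiffAt (hw z hz') hzmax)⟩

theorem DistribLeLaplacian.le_laplacian_of_isLocalMax_sub {x : E}
    (h : DistribLeLaplacian μ f A u) (hA : IsOpen A) (hu : ContinuousOn u A)
    (hf : ContinuousOn f A) (hx : x ∈ A) (hw : ContDiffAt ℝ 2 w x)
    (hmax : IsLocalMax (u - w) x) : f x ≤ Δ w x := by
  by_contra! hlt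
  -- Adding `δ‖· - x‖²` to `w` makes the maximum strict, hence stable under mollification of `u`.
  obtain ⟨δ, hδ, hδlt⟩ := exists_pos_mul_lt (sub_pos.2 hlt) (2 * Module.finrank ℝ E : ℝ)
  set Q : E → ℝ := fun y => ‖y - x‖ ^ 2
  have hQ : ContDiff ℝ 2 (δ • Q) := (contDiff_norm_sub_sq x).const_smul δ
  have hW : ContDiffAt ℝ 2 (w + δ • Q) x := hw.add hQ.contDiffAt
  have hΔW : Δ (w + δ • Q) x < f x := by
    rw [hw.laplacian_add hQ.contDiffAt, laplacian_smul δ (contDiff_norm_sub_sq x).contDiffAt,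
      laplacian_norm_sub_sq, smul_eq_mul]
    linarith
  obtain ⟨m, hWm, hmf⟩ := exists_between hΔW
  have hnear : ∀ᶠ y in 𝓝 x, y ∈ A ∧ ContDiffAt ℝ 2 (w + δ • Q) y ∧ Δ (w + δ • Q) y < m ∧
      m < f y ∧ u y - w y ≤ u x - w x := by
    filter_upwards [hA.mem_nhds hx, hW.eventually (by simp),
      (continuousAt_laplacian hW).eventually_lt continuousAt_const hWm,
      continuousAt_const.eventually_lt (hf.continuousAt (hA.mem_nhds hx)) hmf, hmax]
      with y h₁ h₂ h₃ h₄ h₅ using ⟨h₁, h₂, h₃, h₄, h₅⟩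
  obtain ⟨r, hr, hball⟩ := Metric.eventually_nhds_iff_ball.1 hnear
  have hsub : ball x r ⊆ A := fun y hy => (hball y hy).1
  have hr2 : closedBall x (r / 2) ⊆ ball x r := closedBall_subset_ball (half_lt_self hr)
  obtain ⟨z, hz, hzΔ⟩ := DistribLeLaplacian.exists_mem_ball_le_laplacian (w := w + δ • Q)
    (h.mono isOpen_ball hsub (hf.mono hsub) continuousOn_const (hu.mono hsub)
      fun y hy => (hball y hy).2.2.2.1.le)
    isOpen_ball (hu.mono hsub) hr2 (half_pos hr) hδ (fun y hy => (hball y (hr2 hy)).2.1)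
    fun y hy => by
      have := (hball y (hr2 hy)).2.2.2.2
      simp only [Q, Pi.add_apply, Pi.smul_apply, smul_eq_mul, sub_self, norm_zero, ne_eq,
        OfNat.ofNat_ne_zero, not_false_eq_true, zero_pow, mul_zero, add_zero]
      linarith
  exact absurd hzΔ (hball z (hr2 (ball_subset_closedBall hz))).2.2.1.not_ge

end Touching

section Viscosity

variable {E : Type*} [NormedAddCommGroup E] [InnerProductSpace ℝ E] [FiniteDimensional ℝ E]
  {F : ℝ → E → ℝ} {A B : Set E} {u w σ : E → ℝ}

/-- `F u (∇u) ≤ Δ u` in the viscosity sense in the open set `A`: the inequality holds with the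
derivatives of `u` replaced by those of any `C²` function touching `u` from above. -/
def IsViscositySubsolution (F : ℝ → E → ℝ) (A : Set E) (u : E → ℝ) : Prop :=
  ∀ x ∈ A, ∀ w : E → ℝ, ContDiffAt ℝ 2 w x → IsLocalMax (u - w) x → F (u x) (∇ w x) ≤ Δ w x

namespace IsViscositySubsolution

theorem mono (hu : IsViscositySubsolution F A u) (hBA : B ⊆ A) : IsViscositySubsolution F B u :=
  fun x hx => hu x (hBA hx)

theorem le_of_supersolution (hu : IsViscositySubsolution F A u) (hF : ∀ v, StrictMono (F · v))
    (hA : IsOpen A) (hAb : Bornology.IsBounded A) (husc : UpperSemicontinuousOn u (closure A))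
    (hwc : ContinuousOn w (closure A)) (hw : ∀ x ∈ A, ContDiffAt ℝ 2 w x)
    (hsuper : ∀ x ∈ A, Δ w x ≤ F (w x) (∇ w x)) (hbd : ∀ x ∈ frontier A, u x ≤ w x) {x : E}
    (hx : x ∈ A) : u x ≤ w x := by
  by_contra! hlt
  have husc' : UpperSemicontinuousOn (u - w) (closure A) := by
    rw [sub_eq_add_neg]
    exact husc.add hwc.neg.upperSemicontinuousOn
  obtain ⟨z, hz, hzmax⟩ := husc'.exists_isMaxOn ⟨x, subset_closure hx⟩ hAb.isCompact_closure
  have hwz : w z < u z := sub_pos.1 ((sub_pos.2 hlt).trans_le (hzmax (subset_closure hx)))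
  have hzA : z ∈ A := by
    by_contra h
    exact hwz.not_ge (hbd z ⟨hz, fun hz' => h (interior_subset hz')⟩)
  have hloc : IsLocalMax (u - w) z :=
    hzmax.isLocalMax (mem_of_superset (hA.mem_nhds hzA) subset_closure)
  exact ((hu z hzA w (hw z hzA) hloc).trans (hsuper z hzA)).not_gt (hF _ hwz)

theorem le_of_supersolution_inter {C : Set E} (hu : IsViscositySubsolution F A u)
    (hF : ∀ v, StrictMono (F · v)) (hA : IsOpen A)
    (husc : UpperSemicontinuousOn u (closure A \ {0})) (hbd : ∀ x ∈ frontier A \ {0}, u x ≤ 0)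
    (hC : IsOpen C) (hCb : Bornology.IsBounded C) (hC₀ : 0 ∉ closure C)
    (hw : ∀ x ∈ closure C, ContDiffAt ℝ 2 w x) (hw₀ : ∀ x ∈ closure C, 0 ≤ w x)
    (hsuper : ∀ x ∈ C, Δ w x ≤ F (w x) (∇ w x)) (hle : ∀ x ∈ A ∩ frontier C, u x ≤ w x) {x : E}
    (hxA : x ∈ A) (hxC : x ∈ C) : u x ≤ w x := by
  have hclosure : closure (A ∩ C) ⊆ closure A ∩ closure C := closure_inter_subset_inter_closure A C
  have hne : ∀ {y}, y ∈ closure C → y ≠ 0 := fun h h₀ => hC₀ (h₀ ▸ h)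
  refine (hu.mono inter_subset_left).le_of_supersolution hF (hA.inter hC)
    (hCb.subset inter_subset_right) (husc.mono fun y hy => ⟨(hclosure hy).1, hne (hclosure hy).2⟩)
    (fun y hy => (hw y (hclosure hy).2).continuousAt.continuousWithinAt)
    (fun y hy => hw y (subset_closure hy.2)) (fun y hy => hsuper y hy.2) (fun y hy => ?_)
    ⟨hxA, hxC⟩
  obtain ⟨hyA, hyC⟩ := hclosure hy.1
  by_cases hyA' : y ∈ A
  · refine hle y ⟨hyA', hyC, fun hyC' => hy.2 ?_⟩
    exact (hA.inter hC).interior_eq.symm ▸ ⟨hyA', interior_subset hyC'⟩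
  · exact (hbd y ⟨⟨hyA, fun h => hyA' (interior_subset h)⟩, hne hyC⟩).trans (hw₀ y hyC)

theorem le_blowupProfile {D k ε R : ℝ} (hu : IsViscositySubsolution F A u)
    (hF : ∀ v, StrictMono (F · v)) (hA : IsOpen A)
    (husc : UpperSemicontinuousOn u (closure A \ {0})) (hbd : ∀ x ∈ frontier A \ {0}, u x ≤ 0)
    (hD : 0 < D) (hk : 0 < k) (hε : 0 ≤ ε) (hσ : ContDiff ℝ 2 σ) (hσ₀ : σ 0 < 0)
    (hsuper : ∀ x, 0 < σ x → Δ (fun y => blowupProfile D k ε (σ y)) x ≤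
      F (blowupProfile D k ε (σ x)) (∇ (fun y => blowupProfile D k ε (σ y)) x))
    (hR : ∀ x ∈ A, 0 < σ x → ‖x‖ = R → u x ≤ blowupProfile D k ε (σ x))
    {x : E} (hx : x ∈ A) (hσx : 0 < σ x) (hxR : ‖x‖ < R) :
    u x ≤ blowupProfile D k ε (σ x) := by
  have hK : IsCompact (closure A ∩ ({y | 0 ≤ σ y} ∩ closedBall 0 R)) :=
    ((isCompact_closedBall 0 R).inter_left
      (isClosed_le continuous_const hσ.continuous)).inter_left isClosed_closure
  obtain ⟨B, hB⟩ := (husc.mono fun y hy => ⟨hy.1, fun h => (h ▸ hy.2.1.out).not_gt hσ₀⟩ :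
    UpperSemicontinuousOn u (closure A ∩ ({y | 0 ≤ σ y} ∩ closedBall 0 R))).bddAbove_of_isCompact hK
  obtain ⟨τ, hτ, hτx, hBτ⟩ := blowupProfile.exists_lt_le (ε := ε) hD hk B hσx
  set C := {y | τ < σ y} ∩ ball 0 R
  have hC : IsOpen C := (isOpen_lt continuous_const hσ.continuous).inter isOpen_ball
  have hclosure : closure C ⊆ {y | τ ≤ σ y} ∩ closedBall 0 R :=
    closure_minimal (inter_subset_inter (fun y (hy : τ < σ y) => hy.le) ball_subset_closedBall)
      ((isClosed_le continuous_const hσ.continuous).inter isClosed_closedBall)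
  have hpos : ∀ {y}, y ∈ closure C → 0 < σ y := fun hy => hτ.trans_le (hclosure hy).1
  refine hu.le_of_supersolution_inter (w := fun y => blowupProfile D k ε (σ y)) hF hA husc hbd hC
    (isBounded_ball.subset inter_subset_right) (fun h => (hpos h).not_gt hσ₀)
    (fun y hy => (blowupProfile.contDiffAt (hpos hy).ne').fun_comp y hσ.contDiffAt)
    (fun y hy => (blowupProfile.pos hD hε (hpos hy)).le)
    (fun y hy => hsuper y (hpos (subset_closure hy))) (fun y hy => ?_) hx
    ⟨hτx, mem_ball_zero_iff.2 hxR⟩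
  obtain ⟨hτy, hyR⟩ := hclosure hy.2.1
  rcases hτy.out.eq_or_lt with hτy | hτy
  · rw [← hτy]
    exact (hB ⟨y, ⟨subset_closure hy.1, (hpos hy.2.1).le, hyR⟩, rfl⟩).trans hBτ
  · refine hR y hy.1 (hpos hy.2.1) ((mem_closedBall_zero_iff.1 hyR).antisymm (not_lt.1 fun h => ?_))
    exact hy.2.2 (hC.interior_eq.symm ▸ ⟨hτy, mem_ball_zero_iff.2 h⟩)

end IsViscositySubsolution

end Viscosity

section Nonlinearity

/-- The nonlinearity `|s|^{p-1} s - M |v|^q` of the equation `Δ u = |u|^{p-1} u - M |∇u|^q`. -/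
noncomputable def nonlinearity {E : Type*} [Norm E] (p q M s : ℝ) (v : E) : ℝ :=
  |s| ^ (p - 1) * s - M * ‖v‖ ^ q

theorem abs_rpow_sub_one_mul_self {p s : ℝ} (hp : p ≠ 0) (hs : 0 ≤ s) :
    |s| ^ (p - 1) * s = s ^ p := by
  rcases hs.eq_or_lt with rfl | hs
  · simp [hp]
  · rw [abs_of_pos hs, ← Real.rpow_add_one hs.ne', sub_add_cancel]

theorem nonlinearity_strictMono {E : Type*} [Norm E] {p : ℝ} (hp : 0 < p) (q M : ℝ) (v : E) :
    StrictMono fun s => nonlinearity p q M s v := by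
  refine StrictMono.add_const (strictMono_of_odd_strictMonoOn_nonneg (fun s => by simp) ?_) _
  exact (Real.strictMonoOn_rpow_Ici_of_exponent_pos hp).congr fun s hs =>
    (abs_rpow_sub_one_mul_self hp.ne' hs).symm

variable {E : Type*} [NormedAddCommGroup E] [InnerProductSpace ℝ E] [FiniteDimensional ℝ E]
  {A : Set E} {u w : E → ℝ}

theorem continuousOn_gradient (hu : ContDiffOn ℝ 1 u A) (hA : IsOpen A) : ContinuousOn (∇ u) A :=
  (toDual ℝ E).symm.continuous.comp_continuousOn (hu.continuousOn_fderiv_of_isOpen hA le_rfl)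

theorem gradient_eq_of_isLocalMax_sub {x : E} (hu : DifferentiableAt ℝ u x)
    (hw : DifferentiableAt ℝ w x) (hmax : IsLocalMax (u - w) x) : ∇ u x = ∇ w x := by
  have h := hmax.fderiv_eq_zero
  rw [fderiv_sub hu hw, sub_eq_zero] at h
  rw [gradient, gradient, h]

theorem SolvesInDistributions.isViscositySubsolution {N : ℕ} {p q M : ℝ}
    {A : Set (EuclideanSpace ℝ (Fin N))} {u : EuclideanSpace ℝ (Fin N) → ℝ}
    (h : SolvesInDistributions p q M A u) (hA : IsOpen A) (hu : ContDiffOn ℝ 1 u A) (hp : 1 ≤ p)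
    (hq : 0 ≤ q) : IsViscositySubsolution (nonlinearity p q M) A u := by
  intro x hx w hw hmax
  have hgrad := gradient_eq_of_isLocalMax_sub
    ((hu.contDiffAt (hA.mem_nhds hx)).differentiableAt one_ne_zero)
    (hw.differentiableAt two_ne_zero) hmax
  have hle : DistribLeLaplacian volume (fun x => nonlinearity p q M (u x) (∇ u x)) A u :=
    fun φ hφ hφc hφA _ => (h φ hφ hφc hφA).le
  rw [← hgrad]
  refine hle.le_laplacian_of_isLocalMax_sub hA hu.continuousOn ?_ hx hw hmax
  exact ((hu.continuousOn.abs.rpow_const fun _ _ => Or.inr (sub_nonneg.2 hp)).mul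
    hu.continuousOn).sub (continuousOn_const.mul
      ((continuousOn_gradient hu hA).norm.rpow_const fun _ _ => Or.inr hq))

end Nonlinearity

section BallBarrier

variable {E : Type*} [NormedAddCommGroup E]

/-- The normalized defect `1 - |x - x₀|² / r²`, positive exactly in the ball of centre `x₀` and
radius `r`; the Keller–Osserman barriers on that ball are its negative powers. -/
noncomputable def ballDefect (x₀ : E) (r : ℝ) (x : E) : ℝ := 1 - ‖x - x₀‖ ^ 2 / r ^ 2

namespace ballDefect

variable {x₀ x : E} {D k r p q M : ℝ}

theorem self (x₀ : E) (r : ℝ) : ballDefect x₀ r x₀ = 1 := by simp [ballDefect]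

theorem le_one (x₀ : E) (r : ℝ) (x : E) : ballDefect x₀ r x ≤ 1 :=
  sub_le_self _ (by positivity)

theorem pos_iff (hr : 0 < r) : 0 < ballDefect x₀ r x ↔ ‖x - x₀‖ < r := by
  rw [ballDefect, sub_pos, div_lt_one (by positivity), sq_lt_sq₀ (norm_nonneg _) hr.le]

variable [InnerProductSpace ℝ E]

theorem contDiff (x₀ : E) (r : ℝ) : ContDiff ℝ 2 (ballDefect x₀ r) :=
  contDiff_const.sub ((contDiff_norm_sub_sq x₀).div_const _)

variable [FiniteDimensional ℝ E]

theorem norm_gradient (x₀ : E) (r : ℝ) (x : E) :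
    ‖∇ (ballDefect x₀ r) x‖ = 2 * ‖x - x₀‖ / r ^ 2 := by
  have h := gradient_comp (h := fun s => 1 - s / r ^ 2) (φ := fun y => ‖y - x₀‖ ^ 2) (x := x)
    (by fun_prop) ((contDiff_norm_sub_sq x₀).differentiable two_ne_zero x)
  have hderiv : ∀ s, deriv (fun s => 1 - s / r ^ 2) s = -(r ^ 2)⁻¹ := fun s => by simp
  rw [gradient_norm_sub_sq, hderiv] at h
  rw [show ballDefect x₀ r = fun y => 1 - ‖y - x₀‖ ^ 2 / r ^ 2 from rfl, h, norm_smul, norm_smul,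
    norm_neg, norm_inv, norm_pow, Real.norm_eq_abs, sq_abs, Real.norm_two]
  ring

theorem laplacian (x₀ : E) (r : ℝ) (x : E) :
    Δ (ballDefect x₀ r) x = -(2 * Module.finrank ℝ E / r ^ 2) := by
  have hQ := (contDiff_norm_sub_sq x₀).contDiffAt (x := x)
  have hsmul : ContDiffAt ℝ 2 ((r ^ 2)⁻¹ • fun y => ‖y - x₀‖ ^ 2) x := hQ.const_smul ((r ^ 2)⁻¹)
  have hsub : ballDefect x₀ r = (fun _ => 1) - (r ^ 2)⁻¹ • fun y => ‖y - x₀‖ ^ 2 := by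
    ext y
    simp [ballDefect, div_eq_inv_mul]
  rw [hsub, contDiffAt_const.laplacian_sub hsmul, laplacian_smul _ hQ, laplacian_norm_sub_sq,
    laplacian_const]
  simp only [Pi.zero_apply, smul_eq_mul]
  ring

theorem laplacian_blowupProfile_le (hr : 0 < r) (hD : 0 ≤ D) (hk : 0 ≤ k)
    (hx : 0 < ballDefect x₀ r x) :
    Δ (fun y => blowupProfile D k 0 (ballDefect x₀ r y)) x ≤
      (2 * k * Module.finrank ℝ E + 4 * k * (k + 1)) * D / r ^ 2 *
        ballDefect x₀ r x ^ (-(k + 2)) := by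
  have hmono : ballDefect x₀ r x ^ (-(k + 1)) ≤ ballDefect x₀ r x ^ (-(k + 2)) :=
    Real.rpow_le_rpow_of_exponent_ge hx (le_one x₀ r x) (by linarith)
  have hxr : ‖x - x₀‖ ≤ r := ((pos_iff hr).1 hx).le
  have := hx.le
  rw [blowupProfile.laplacian_comp (contDiff x₀ r).contDiffAt hx, norm_gradient, laplacian]
  calc _ = D * k * (k + 1) * ballDefect x₀ r x ^ (-(k + 2)) * (2 * ‖x - x₀‖ / r ^ 2) ^ 2 +
        D * k * ballDefect x₀ r x ^ (-(k + 1)) * (2 * Module.finrank ℝ E / r ^ 2) := by ring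
    _ ≤ D * k * (k + 1) * ballDefect x₀ r x ^ (-(k + 2)) * (2 * r / r ^ 2) ^ 2 +
        D * k * ballDefect x₀ r x ^ (-(k + 2)) * (2 * Module.finrank ℝ E / r ^ 2) := by gcongr
    _ = _ := by field_simp; ring

theorem norm_gradient_blowupProfile_le (hr : 0 < r) (hD : 0 ≤ D) (hk : 0 ≤ k)
    (hx : 0 < ballDefect x₀ r x) :
    ‖∇ (fun y => blowupProfile D k 0 (ballDefect x₀ r y)) x‖ ≤
      2 * k / r * (D * ballDefect x₀ r x ^ (-(k + 1))) := by
  have hxr : ‖x - x₀‖ ≤ r := ((pos_iff hr).1 hx).le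
  have := hx.le
  rw [blowupProfile.norm_gradient_comp hD hk ((contDiff x₀ r).differentiable two_ne_zero x) hx,
    norm_gradient]
  calc _ ≤ D * k * ballDefect x₀ r x ^ (-(k + 1)) * (2 * r / r ^ 2) := by gcongr
    _ = _ := by field_simp

theorem laplacian_blowupProfile_le_half (hr : 0 < r) (hD : 0 < D) (hk : 0 ≤ k)
    (hkp : k + 2 ≤ k * p)
    (hDp : 2 * (2 * k * Module.finrank ℝ E + 4 * k * (k + 1)) / r ^ 2 ≤ D ^ (p - 1))
    (hx : 0 < ballDefect x₀ r x) :
    Δ (fun y => blowupProfile D k 0 (ballDefect x₀ r y)) x ≤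
      blowupProfile D k 0 (ballDefect x₀ r x) ^ p / 2 := by
  have hmono : ballDefect x₀ r x ^ (-(k + 2)) ≤ ballDefect x₀ r x ^ (-(k * p)) :=
    Real.rpow_le_rpow_of_exponent_ge hx (le_one x₀ r x) (neg_le_neg hkp)
  have hσ := hx.le
  calc _ ≤ (2 * k * Module.finrank ℝ E + 4 * k * (k + 1)) * D / r ^ 2 *
        ballDefect x₀ r x ^ (-(k + 2)) := laplacian_blowupProfile_le hr hD.le hk hx
    _ = 2 * (2 * k * Module.finrank ℝ E + 4 * k * (k + 1)) / r ^ 2 * D / 2 *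
        ballDefect x₀ r x ^ (-(k + 2)) := by ring
    _ ≤ D ^ (p - 1) * D / 2 * ballDefect x₀ r x ^ (-(k * p)) := by
        gcongr
    _ = _ := by
        rw [blowupProfile.zero_rpow hD.le hσ, ← Real.rpow_add_one hD.ne', sub_add_cancel]
        ring

theorem norm_gradient_blowupProfile_rpow_le_half (hr : 0 < r) (hD : 0 < D) (hk : 0 ≤ k)
    (hM : 0 ≤ M) (hq : 0 ≤ q) (hkq : (k + 1) * q ≤ k * p)
    (hDq : 2 * M * (2 * k / r) ^ q ≤ D ^ (p - q)) (hx : 0 < ballDefect x₀ r x) :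
    M * ‖∇ (fun y => blowupProfile D k 0 (ballDefect x₀ r y)) x‖ ^ q ≤
      blowupProfile D k 0 (ballDefect x₀ r x) ^ p / 2 := by
  have hmono : ballDefect x₀ r x ^ (-((k + 1) * q)) ≤ ballDefect x₀ r x ^ (-(k * p)) :=
    Real.rpow_le_rpow_of_exponent_ge hx (le_one x₀ r x) (neg_le_neg hkq)
  have hσ := hx.le
  calc _ ≤ M * (2 * k / r * (D * ballDefect x₀ r x ^ (-(k + 1)))) ^ q := by
        gcongr
        exact norm_gradient_blowupProfile_le hr hD.le hk hx
    _ = 2 * M * (2 * k / r) ^ q * D ^ q / 2 * ballDefect x₀ r x ^ (-((k + 1) * q)) := by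
        rw [Real.mul_rpow (by positivity) (by positivity), Real.mul_rpow hD.le (by positivity),
          ← Real.rpow_mul hσ, neg_mul]
        ring
    _ ≤ D ^ (p - q) * D ^ q / 2 * ballDefect x₀ r x ^ (-(k * p)) := by
        gcongr
    _ = _ := by
        rw [blowupProfile.zero_rpow hD.le hσ, ← Real.rpow_add hD, sub_add_cancel]
        ring

end ballDefect

variable [InnerProductSpace ℝ E] [FiniteDimensional ℝ E] {A : Set E} {u : E → ℝ} {x₀ x : E}
  {D k r p q M : ℝ}

theorem laplacian_ballBarrier_le_nonlinearity (hr : 0 < r) (hD : 0 < D) (hk : 0 ≤ k)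
    (hkp : k + 2 ≤ k * p)
    (hDp : 2 * (2 * k * Module.finrank ℝ E + 4 * k * (k + 1)) / r ^ 2 ≤ D ^ (p - 1))
    (hM : 0 < M → 0 ≤ q ∧ (k + 1) * q ≤ k * p ∧ 2 * M * (2 * k / r) ^ q ≤ D ^ (p - q))
    (hx : 0 < ballDefect x₀ r x) :
    Δ (fun y => blowupProfile D k 0 (ballDefect x₀ r y)) x ≤
      nonlinearity p q M (blowupProfile D k 0 (ballDefect x₀ r x))
        (∇ (fun y => blowupProfile D k 0 (ballDefect x₀ r y)) x) := by
  have hp : p ≠ 0 := by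
    rintro rfl
    linarith
  have hw : 0 < blowupProfile D k 0 (ballDefect x₀ r x) := blowupProfile.pos hD le_rfl hx
  have hΔ := ballDefect.laplacian_blowupProfile_le_half hr hD hk hkp hDp hx
  have hgrad : M * ‖∇ (fun y => blowupProfile D k 0 (ballDefect x₀ r y)) x‖ ^ q ≤
      blowupProfile D k 0 (ballDefect x₀ r x) ^ p / 2 := by
    rcases le_or_gt M 0 with hM₀ | hM₀
    · exact (mul_nonpos_of_nonpos_of_nonneg hM₀ (by positivity)).trans (by positivity)
    · obtain ⟨hq, hkq, hDq⟩ := hM hM₀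
      exact ballDefect.norm_gradient_blowupProfile_rpow_le_half hr hD hk hM₀.le hq hkq hDq hx
  rw [nonlinearity, abs_rpow_sub_one_mul_self hp hw.le]
  linarith

theorem IsViscositySubsolution.le_of_ball
    (hu : IsViscositySubsolution (nonlinearity p q M) A u) (hA : IsOpen A)
    (husc : UpperSemicontinuousOn u (closure A \ {0}))
    (hbd : ∀ x ∈ frontier A \ {0}, u x ≤ 0) (hr : 0 < r) (hD : 0 < D) (hk : 0 < k)
    (hkp : k + 2 ≤ k * p)
    (hDp : 2 * (2 * k * Module.finrank ℝ E + 4 * k * (k + 1)) / r ^ 2 ≤ D ^ (p - 1))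
    (hM : 0 < M → 0 ≤ q ∧ (k + 1) * q ≤ k * p ∧ 2 * M * (2 * k / r) ^ q ≤ D ^ (p - q))
    (hx₀ : x₀ ∈ A) (hrx₀ : r < ‖x₀‖) : u x₀ ≤ D := by
  have hp : 0 < p := pos_of_mul_pos_right (by linarith) hk.le
  have hσ₀ : ballDefect x₀ r 0 < 0 := by
    rw [ballDefect, sub_neg, one_lt_div (by positivity), zero_sub, norm_neg]
    gcongr
  have hsphere : ∀ x ∈ A, 0 < ballDefect x₀ r x → ‖x‖ = ‖x₀‖ + r →
      u x ≤ blowupProfile D k 0 (ballDefect x₀ r x) := fun x _ hx hxR => by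
    linarith [(ballDefect.pos_iff hr).1 hx, norm_sub_norm_le x x₀]
  have hle := hu.le_blowupProfile (nonlinearity_strictMono hp q M) hA husc hbd hD hk le_rfl
    (ballDefect.contDiff x₀ r) hσ₀
    (fun x hx => laplacian_ballBarrier_le_nonlinearity hr hD hk.le hkp hDp hM hx)
    hsphere hx₀ (by simp [ballDefect.self]) (lt_add_of_pos_right _ hr)
  simpa only [blowupProfile, ballDefect.self, Real.one_rpow, mul_one, add_zero] using hle

end BallBarrier

section HalfSpaceBarrier

variable {E : Type*} [NormedAddCommGroup E] [InnerProductSpace ℝ E] [FiniteDimensional ℝ E]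
  {A : Set E} {u : E → ℝ} {e x x₀ : E} {C α δ ε p q M : ℝ}

theorem laplacian_halfSpaceBarrier_le_nonlinearity (he : ‖e‖ = 1) (hC : 0 < C) (hα : 0 ≤ α)
    (hε : 0 ≤ ε) (hαq : (α + 1) * q = α + 2) (hCM : C * α * (α + 1) ≤ -M * (C * α) ^ q)
    (hx : 0 < inner ℝ e x - δ) :
    Δ (fun y => blowupProfile C α ε (inner ℝ e y - δ)) x ≤
      nonlinearity p q M (blowupProfile C α ε (inner ℝ e x - δ))
        (∇ (fun y => blowupProfile C α ε (inner ℝ e y - δ)) x) := by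
  have hσ : ContDiff ℝ 2 fun y => inner ℝ e y - δ :=
    (contDiff_const.inner ℝ contDiff_id).sub contDiff_const
  have hw := blowupProfile.pos hC hε hx (k := α)
  have hs := hx.le
  have hgrad : ‖∇ (fun y => blowupProfile C α ε (inner ℝ e y - δ)) x‖ ^ q =
      (C * α) ^ q * (inner ℝ e x - δ) ^ (-(α + 2)) := by
    rw [blowupProfile.norm_gradient_comp hC.le hα (hσ.differentiable two_ne_zero x) hx,
      gradient_inner_sub_const, he, mul_one, Real.mul_rpow (by positivity) (by positivity),
      ← Real.rpow_mul hs, neg_mul, hαq]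
  calc Δ (fun y => blowupProfile C α ε (inner ℝ e y - δ)) x
      = C * α * (α + 1) * (inner ℝ e x - δ) ^ (-(α + 2)) := by
        rw [blowupProfile.laplacian_comp hσ.contDiffAt hx, gradient_inner_sub_const,
          laplacian_inner_sub_const, he]
        ring
    _ ≤ -M * (C * α) ^ q * (inner ℝ e x - δ) ^ (-(α + 2)) := by gcongr
    _ = -(M * ‖∇ (fun y => blowupProfile C α ε (inner ℝ e y - δ)) x‖ ^ q) := by
        rw [hgrad]
        ring
    _ ≤ _ := by
        rw [nonlinearity, le_sub_iff_add_le, neg_add_cancel]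
        positivity

namespace IsViscositySubsolution

theorem le_blowupProfile_inner_sub (hu : IsViscositySubsolution (nonlinearity p q M) A u)
    (hA : IsOpen A) (husc : UpperSemicontinuousOn u (closure A \ {0}))
    (hbd : ∀ x ∈ frontier A \ {0}, u x ≤ 0) (hp : 0 < p) (he : ‖e‖ = 1) (hC : 0 < C) (hα : 0 < α)
    (hαq : (α + 1) * q = α + 2) (hCM : C * α * (α + 1) ≤ -M * (C * α) ^ q) (hδ : 0 < δ)
    (hε : 0 ≤ ε) (hdecay : ∀ᶠ x in Bornology.cobounded E, x ∈ A → u x ≤ ε) (hx₀ : x₀ ∈ A)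
    (hδx₀ : 0 < inner ℝ e x₀ - δ) : u x₀ ≤ blowupProfile C α ε (inner ℝ e x₀ - δ) := by
  obtain ⟨R, -, hR⟩ := hasBasis_cobounded_norm.eventually_iff.1 hdecay
  refine hu.le_blowupProfile (R := max R (‖x₀‖ + 1)) (nonlinearity_strictMono hp q M) hA husc hbd
    hC hα hε ((contDiff_const.inner ℝ contDiff_id).sub contDiff_const) (by simpa using hδ)
    (fun x hx => laplacian_halfSpaceBarrier_le_nonlinearity he hC hα.le hε hαq hCM hx)
    (fun x hxA hx hxR => ?_) hx₀ hδx₀ (lt_max_of_lt_right (lt_add_one _))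
  calc u x ≤ ε := hR (hxR.ge.trans' (le_max_left _ _)) hxA
    _ ≤ blowupProfile C α ε (inner ℝ e x - δ) :=
      le_add_of_nonneg_left (mul_nonneg hC.le (Real.rpow_nonneg hx.le _))

theorem le_of_halfSpace (hu : IsViscositySubsolution (nonlinearity p q M) A u)
    (hA : IsOpen A) (husc : UpperSemicontinuousOn u (closure A \ {0}))
    (hbd : ∀ x ∈ frontier A \ {0}, u x ≤ 0) (hp : 0 < p) (hC : 0 < C) (hα : 0 < α)
    (hαq : (α + 1) * q = α + 2) (hCM : C * α * (α + 1) ≤ -M * (C * α) ^ q)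
    (hdecay : ∀ ε > 0, ∀ᶠ x in Bornology.cobounded E, x ∈ A → u x ≤ ε) (hx₀ : x₀ ∈ A)
    (hx₀' : x₀ ≠ 0) : u x₀ ≤ C * ‖x₀‖ ^ (-α) := by
  have hpos : 0 < ‖x₀‖ := norm_pos_iff.2 hx₀'
  have he : ‖‖x₀‖⁻¹ • x₀‖ = 1 := norm_smul_inv_norm (𝕜 := ℝ) hx₀'
  have hinner : inner ℝ (‖x₀‖⁻¹ • x₀) x₀ = ‖x₀‖ := by
    rw [real_inner_smul_left, real_inner_self_eq_norm_mul_norm, inv_mul_cancel_left₀ hpos.ne']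
  have hcont : ContinuousAt (fun δ => blowupProfile C α δ (‖x₀‖ - δ)) 0 := by
    refine (continuousAt_const.mul (ContinuousAt.rpow_const (by fun_prop) (Or.inl ?_))).add
      continuousAt_id
    rwa [sub_zero, norm_ne_zero_iff]
  have hlim : Tendsto (fun δ => blowupProfile C α δ (‖x₀‖ - δ)) (𝓝[>] 0)
      (𝓝 (C * ‖x₀‖ ^ (-α))) := by
    simpa [blowupProfile] using hcont.tendsto.mono_left nhdsWithin_le_nhds
  refine ge_of_tendsto hlim ?_
  filter_upwards [Ioo_mem_nhdsGT hpos] with δ ⟨hδ, hδx₀⟩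
  have h := hu.le_blowupProfile_inner_sub hA husc hbd hp he hC hα hαq hCM hδ hδ.le
    (hdecay δ hδ) hx₀ (by rwa [hinner, sub_pos])
  rwa [hinner] at h

end IsViscositySubsolution

end HalfSpaceBarrier

section Constants

variable {p q : ℝ}

/-- The constant `c₇` in the bound by absorption alone, in dimension `n`. The absolute value makes
it positive also for the irrelevant exponents `p ≤ 1`. -/
noncomputable def absorptionConst (n : ℕ) (p : ℝ) : ℝ :=
  (1 + 8 * (2 * |2 / (p - 1)| * n + 4 * |2 / (p - 1)| * (|2 / (p - 1)| + 1))) ^ (1 / (p - 1))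

/-- The exponent of the ball barrier used when the gradient term is a source: the larger of the
blow-up rates for which absorption dominates the Laplacian and the gradient term, respectively. -/
noncomputable def sourceExponent (p q : ℝ) : ℝ := max |2 / (p - 1)| |q / (p - q)|

/-- The constant `c₅` in the bound with a gradient source, in dimension `n`. The two entries make
half of the absorption dominate the Laplacian and the gradient term, respectively. -/
noncomputable def sourceConst (n : ℕ) (p q : ℝ) : ℝ :=
  max ((1 + 8 * (2 * sourceExponent p q * n +
      4 * sourceExponent p q * (sourceExponent p q + 1))) ^ (1 / (p - 1)))
    ((2 * (4 * sourceExponent p q) ^ q) ^ (1 / (p - q)))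

/-- The constant `c₆` in the bound by gradient absorption alone. It is at least the value
`(α + 1) ^ (1 / (q - 1)) / α`, where `α = (2 - q) / (q - 1)`, required of the half-space barrier,
and positive for every `q`. -/
noncomputable def gradientConst (q : ℝ) : ℝ :=
  (|(2 - q) / (q - 1)| + 1) ^ (1 / (q - 1)) * (1 + |(2 - q) / (q - 1)|⁻¹)

theorem absorptionConst_pos (n : ℕ) (p : ℝ) : 0 < absorptionConst n p := by
  unfold absorptionConst
  positivity

theorem sourceExponent_nonneg (p q : ℝ) : 0 ≤ sourceExponent p q :=
  (abs_nonneg _).trans (le_max_left _ _)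

theorem sourceConst_pos (n : ℕ) (p q : ℝ) : 0 < sourceConst n p q := by
  have := sourceExponent_nonneg p q
  exact lt_max_of_lt_left (by positivity)

theorem gradientConst_pos (q : ℝ) : 0 < gradientConst q := by
  unfold gradientConst
  positivity

theorem rpow_one_div_mul_rpow_neg_rpow {a R s : ℝ} (ha : 0 ≤ a) (hR : 0 ≤ R) (hs : s ≠ 0) (t : ℝ) :
    (a ^ (1 / s) * R ^ (-(t / s))) ^ s = a * R ^ (-t) := by
  rw [Real.mul_rpow (by positivity) (by positivity), ← Real.rpow_mul ha, ← Real.rpow_mul hR,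
    one_div_mul_cancel hs, Real.rpow_one, neg_mul, div_mul_cancel₀ _ hs]

theorem gradientConst_supersolution {M : ℝ} (hq : 1 < q) (hq₂ : q < 2) (hM : M < 0) :
    gradientConst q * |M| ^ (-(1 / (q - 1))) * ((2 - q) / (q - 1)) * ((2 - q) / (q - 1) + 1) ≤
      -M * (gradientConst q * |M| ^ (-(1 / (q - 1))) * ((2 - q) / (q - 1))) ^ q := by
  have hq₁ : 0 < q - 1 := sub_pos.2 hq
  have hα : 0 < (2 - q) / (q - 1) := div_pos (sub_pos.2 hq₂) hq₁
  have hM' : 0 < -M := neg_pos.2 hM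
  have hc := gradientConst_pos q
  have hcα : ((2 - q) / (q - 1) + 1) ^ (1 / (q - 1)) ≤
      gradientConst q * ((2 - q) / (q - 1)) := by
    rw [gradientConst, abs_of_pos hα, mul_assoc, add_mul, one_mul, inv_mul_cancel₀ hα.ne']
    exact le_mul_of_one_le_right (by positivity) (le_add_of_nonneg_left hα.le)
  rw [abs_of_neg hM]
  set α := (2 - q) / (q - 1)
  set C := gradientConst q * (-M) ^ (-(1 / (q - 1)))
  have hCα : (α + 1) ^ (1 / (q - 1)) * (-M) ^ (-(1 / (q - 1))) ≤ C * α := by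
    calc _ ≤ gradientConst q * α * (-M) ^ (-(1 / (q - 1))) := by gcongr
      _ = C * α := mul_right_comm _ _ _
  have hpow : (α + 1) * (-M) ^ (-1 : ℝ) ≤ (C * α) ^ (q - 1) := by
    rw [← rpow_one_div_mul_rpow_neg_rpow (by positivity) hM'.le hq₁.ne']
    gcongr
  calc C * α * (α + 1) = C * α * (-M * ((α + 1) * (-M) ^ (-1 : ℝ))) := by
        rw [Real.rpow_neg_one, mul_left_comm (-M), mul_inv_cancel₀ hM'.ne', mul_one]
    _ ≤ C * α * (-M * (C * α) ^ (q - 1)) := by gcongr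
    _ = -M * (C * α) ^ q := by
        rw [show q = 1 + (q - 1) by ring, Real.rpow_one_add' (by positivity) (by linarith)]
        ring_nf

end Constants

namespace IsViscositySubsolution

variable {E : Type*} [NormedAddCommGroup E] [InnerProductSpace ℝ E] [FiniteDimensional ℝ E]
  {A : Set E} {u : E → ℝ} {x : E} {p q M : ℝ}

theorem le_of_ball_half_norm {D k : ℝ} (hu : IsViscositySubsolution (nonlinearity p q M) A u)
    (hA : IsOpen A) (husc : UpperSemicontinuousOn u (closure A \ {0}))
    (hbd : ∀ x ∈ frontier A \ {0}, u x ≤ 0) (hD : 0 < D) (hk : 0 < k)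
    (hkp : k + 2 ≤ k * p)
    (hDp : 8 * (2 * k * Module.finrank ℝ E + 4 * k * (k + 1)) * ‖x‖ ^ (-2 : ℝ) ≤ D ^ (p - 1))
    (hM : 0 < M →
      0 ≤ q ∧ (k + 1) * q ≤ k * p ∧ 2 * (4 * k) ^ q * M * ‖x‖ ^ (-q) ≤ D ^ (p - q))
    (hx : x ∈ A) (hx₀ : x ≠ 0) : u x ≤ D := by
  have hR : 0 < ‖x‖ := norm_pos_iff.2 hx₀
  refine hu.le_of_ball hA husc hbd (half_pos hR) hD hk hkp (hDp.trans_eq' ?_)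
    (fun hM₀ => ⟨(hM hM₀).1, (hM hM₀).2.1, (hM hM₀).2.2.trans_eq' ?_⟩) hx (half_lt_self hR)
  · rw [Real.rpow_neg hR.le, Real.rpow_two]
    field_simp
    norm_num
  · rw [show 2 * k / (‖x‖ / 2) = 4 * k * ‖x‖⁻¹ by field_simp; norm_num,
      Real.mul_rpow (x := 4 * k) (by positivity) (by positivity), Real.inv_rpow hR.le,
      Real.rpow_neg hR.le]
    ring

theorem le_absorption (hu : IsViscositySubsolution (nonlinearity p q M) A u) (hA : IsOpen A)
    (husc : UpperSemicontinuousOn u (closure A \ {0})) (hbd : ∀ x ∈ frontier A \ {0}, u x ≤ 0)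
    (hp : 1 < p) (hM : M ≤ 0) (hx : x ∈ A) (hx₀ : x ≠ 0) :
    u x ≤ absorptionConst (Module.finrank ℝ E) p * ‖x‖ ^ (-(2 / (p - 1))) := by
  have hp₁ : 0 < p - 1 := sub_pos.2 hp
  have hR : 0 < ‖x‖ := norm_pos_iff.2 hx₀
  have hk : 0 < 2 / (p - 1) := by positivity
  have hkp : 2 / (p - 1) * p = 2 / (p - 1) + 2 := by field_simp; ring
  refine hu.le_of_ball_half_norm hA husc hbd (mul_pos (absorptionConst_pos _ _) (by positivity)) hk
    hkp.ge ?_ (fun h => absurd hM h.not_ge) hx hx₀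
  rw [absorptionConst, abs_of_pos hk,
    rpow_one_div_mul_rpow_neg_rpow (by positivity) hR.le hp₁.ne']
  gcongr
  exact le_add_of_nonneg_left zero_le_one

theorem le_source (hu : IsViscositySubsolution (nonlinearity p q M) A u) (hA : IsOpen A)
    (husc : UpperSemicontinuousOn u (closure A \ {0})) (hbd : ∀ x ∈ frontier A \ {0}, u x ≤ 0)
    (hp : 1 < p) (hq : 0 ≤ q) (hqp : q < p) (hM : 0 < M) (hx : x ∈ A) (hx₀ : x ≠ 0) :
    u x ≤ sourceConst (Module.finrank ℝ E) p q *
      max (M ^ (1 / (p - q)) * ‖x‖ ^ (-(q / (p - q)))) (‖x‖ ^ (-(2 / (p - 1)))) := by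
  have hp₁ : 0 < p - 1 := sub_pos.2 hp
  have hpq : 0 < p - q := sub_pos.2 hqp
  have hR : 0 < ‖x‖ := norm_pos_iff.2 hx₀
  have hk₁ : 2 / (p - 1) ≤ sourceExponent p q := (le_abs_self _).trans (le_max_left _ _)
  have hk₂ : q / (p - q) ≤ sourceExponent p q := (le_abs_self _).trans (le_max_right _ _)
  have hk : 0 < sourceExponent p q := hk₁.trans_lt' (by positivity)
  have hc := sourceConst_pos (Module.finrank ℝ E) p q
  rw [div_le_iff₀ hp₁] at hk₁
  rw [div_le_iff₀ hpq] at hk₂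
  refine hu.le_of_ball_half_norm hA husc hbd
    (mul_pos hc (lt_max_of_lt_right (by positivity))) hk (by linarith) ?_
    (fun _ => ⟨hq, by linarith, ?_⟩) hx hx₀
  · calc _ ≤ (1 + 8 * (2 * sourceExponent p q * Module.finrank ℝ E +
          4 * sourceExponent p q * (sourceExponent p q + 1))) * ‖x‖ ^ (-2 : ℝ) := by
          gcongr
          exact le_add_of_nonneg_left zero_le_one
      _ = _ := (rpow_one_div_mul_rpow_neg_rpow (by positivity) hR.le hp₁.ne' 2).symm
      _ ≤ _ := by
          gcongr
          exacts [le_max_left _ _, le_max_right _ _]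
  · calc _ = _ := (rpow_one_div_mul_rpow_neg_rpow (by positivity) hR.le hpq.ne' q).symm
      _ = ((2 * (4 * sourceExponent p q) ^ q) ^ (1 / (p - q)) *
          (M ^ (1 / (p - q)) * ‖x‖ ^ (-(q / (p - q))))) ^ (p - q) := by
          rw [Real.mul_rpow (by positivity) hM.le, mul_assoc]
      _ ≤ _ := by
          gcongr
          exacts [le_max_right _ _, le_max_left _ _]

theorem le_gradient (hu : IsViscositySubsolution (nonlinearity p q M) A u) (hA : IsOpen A)
    (h₀ : 0 ∉ A) (husc : UpperSemicontinuousOn u (closure A \ {0}))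
    (hbd : ∀ x ∈ frontier A \ {0}, u x ≤ 0) (hp : 1 < p) (hq : 1 < q) (hq₂ : q < 2) (hM : M < 0)
    (hx : x ∈ A) :
    u x ≤ gradientConst q * |M| ^ (-(1 / (q - 1))) * ‖x‖ ^ (-((2 - q) / (q - 1))) := by
  have hq₁ : 0 < q - 1 := sub_pos.2 hq
  have hα : 0 < (2 - q) / (q - 1) := div_pos (sub_pos.2 hq₂) hq₁
  have hαq : ((2 - q) / (q - 1) + 1) * q = (2 - q) / (q - 1) + 2 := by field_simp; ring
  have hM' : 0 < |M| := abs_pos.2 hM.ne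
  have hC : 0 < gradientConst q * |M| ^ (-(1 / (q - 1))) :=
    mul_pos (gradientConst_pos q) (by positivity)
  have hne : ∀ y ∈ A, y ≠ 0 := fun y hy h => h₀ (h ▸ hy)
  refine hu.le_of_halfSpace hA husc hbd (one_pos.trans hp) hC hα hαq ?_ (fun ε hε => ?_) hx
    (hne x hx)
  · exact gradientConst_supersolution hq hq₂ hM
  · have hlim := ((tendsto_rpow_neg_atTop (div_pos two_pos (sub_pos.2 hp))).comp
      (tendsto_norm_cobounded_atTop (E := E))).const_mul
        (absorptionConst (Module.finrank ℝ E) p)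
    rw [mul_zero] at hlim
    filter_upwards [hlim.eventually_le_const hε] with y hy hyA
    exact (hu.le_absorption hA husc hbd hp hM.le hyA (hne y hyA)).trans hy

end IsViscositySubsolution

theorem theorem2p1_general {E : Type*} [NormedAddCommGroup E] [InnerProductSpace ℝ E]
    [FiniteDimensional ℝ E] :
    ∃ (c₅ : ℝ → ℝ → ℝ) (c₆ c₇ : ℝ → ℝ),
      (∀ p q, 0 < c₅ p q) ∧ (∀ q, 0 < c₆ q) ∧ (∀ p, 0 < c₇ p) ∧
      ∀ (p q M : ℝ), 1 < p → ∀ (A : Set E), IsOpen A → 0 ∉ A →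
      ∀ (u : E → ℝ), UpperSemicontinuousOn u (closure A \ {0}) →
        IsViscositySubsolution (nonlinearity p q M) A u → (∀ x ∈ frontier A \ {0}, u x ≤ 0) →
        (0 < M → 0 ≤ q → q < p → ∀ x ∈ A,
          max (u x) 0 ≤ c₅ p q *
            max (M ^ (1 / (p - q)) * ‖x‖ ^ (-(q / (p - q)))) (‖x‖ ^ (-(2 / (p - 1))))) ∧
        (M < 0 → 1 < q → q < 2 → ∀ x ∈ A,
          max (u x) 0 ≤ c₆ q * |M| ^ (-(1 / (q - 1))) * ‖x‖ ^ (-((2 - q) / (q - 1)))) ∧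
        (M ≤ 0 → ∀ x ∈ A, max (u x) 0 ≤ c₇ p * ‖x‖ ^ (-(2 / (p - 1)))) := by
  have hc₅ := sourceConst_pos (Module.finrank ℝ E)
  have hc₇ := absorptionConst_pos (Module.finrank ℝ E)
  refine ⟨_, _, _, hc₅, gradientConst_pos, hc₇, fun p q M hp A hA h₀ u husc hu hbd => ?_⟩
  have hne : ∀ x ∈ A, x ≠ 0 := fun x hx h => h₀ (h ▸ hx)
  have := hc₅ p q
  have := gradientConst_pos q
  have := hc₇ p
  exact ⟨fun hM hq hqp x hx => max_le
      (hu.le_source hA husc hbd hp hq hqp hM hx (hne x hx)) (by positivity),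
    fun hM hq hq₂ x hx => max_le
      (hu.le_gradient hA h₀ husc hbd hp hq hq₂ hM hx) (by positivity),
    fun hM x hx => max_le (hu.le_absorption hA husc hbd hp hM hx (hne x hx)) (by positivity)⟩

theorem theorem2p1 (N : ℕ) :
    ∃ (c₅ : ℝ → ℝ → ℝ) (c₆ c₇ : ℝ → ℝ),
      (∀ p q, 0 < c₅ p q) ∧ (∀ q, 0 < c₆ q) ∧ (∀ p, 0 < c₇ p) ∧
      ∀ (p q M : ℝ), 1 < q → q < min p 2 →
      ∀ (A : Set (EuclideanSpace ℝ (Fin N))), IsOpen A → IsConnected A →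
        (0 : EuclideanSpace ℝ (Fin N)) ∈ frontier A →
      ∀ (u : EuclideanSpace ℝ (Fin N) → ℝ), IsC1OffOrigin A u →
        SolvesInDistributions p q M A u →
        (∀ x ∈ frontier A \ {0}, u x = 0) →
        (0 < M → ∀ x ∈ A,
          max (u x) 0 ≤ c₅ p q *
            max (M ^ (1 / (p - q)) * ‖x‖ ^ (-(q / (p - q)))) (‖x‖ ^ (-(2 / (p - 1))))) ∧
        (M < 0 → ∀ x ∈ A,
          max (u x) 0 ≤
            min (c₆ q * |M| ^ (-(1 / (q - 1))) * ‖x‖ ^ (-((2 - q) / (q - 1))))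
              (c₇ p * ‖x‖ ^ (-(2 / (p - 1))))) ∧
        (M = 0 → ∀ x ∈ A,
          max (u x) 0 ≤ c₇ p * ‖x‖ ^ (-(2 / (p - 1)))) := by
  obtain ⟨c₅, c₆, c₇, hc₅, hc₆, hc₇, h⟩ := theorem2p1_general (E := EuclideanSpace ℝ (Fin N))
  refine ⟨c₅, c₆, c₇, hc₅, hc₆, hc₇, fun p q M hq hqm A hA _ h₀ u hu hsol hbd => ?_⟩
  obtain ⟨hqp, hq₂⟩ := lt_min_iff.1 hqm
  have hp := hq.trans hqp
  have hq₀ := zero_le_one.trans hq.le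
  obtain ⟨hsource, hgradient, habsorption⟩ := h p q M hp A hA (hA.frontier_eq ▸ h₀).2 u
    hu.2.1.upperSemicontinuousOn (hsol.isViscositySubsolution hA hu.1 hp.le hq₀)
    fun x hx => (hbd x hx).le
  exact ⟨fun hM => hsource hM hq₀ hqp,
    fun hM x hx => le_min (hgradient hM hq hq₂ x hx) (habsorption hM.le x hx),
    fun hM => habsorption hM.le⟩
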